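/- Let $n\geq 2$, and let $B_n(\mathbb{R}P^2)$ be the $n$-string braid group of the real projective plane, given by Van Buskirk's presentation: the generators are $\sigma_1,\ldots,\sigma_{n-1},\rho_1,\ldots,\rho_n$, and the relations are \begin{align*} \sigma_i\sigma_j&=\sigma_j\sigma_i &&\text{if } |i-j|\geq 2,\\ \sigma_i\sigma_{i+1}\sigma_i&=\sigma_{i+1}\sigma_i\sigma_{i+1} &&\text{for } 1\leq i\leq n-2,\\ \sigma_i\rho_j&=\rho_j\sigma_i &&\text{for } j\neq i,i+1,\\ \rho_{i+1}&=\sigma_i^{-1}\rho_i\sigma_i^{-1} &&\text{for } 1\leq i\leq n-1,\\ \rho_{i+1}^{-1}\rho_i^{-1}\rho_{i+1}\rho_i&=\sigma_i^2 &&\text{for } 1\leq i\leq n-1,\\ \rho_1^2&=\sigma_1\sigma_2\cdots\sigma_{n-2}\,\sigma_{n-1}^2\,\sigma_{n-2}\cdots\sigma_2\sigma_1. \end{align*} Consider the elements $$a=\sigma_{n-1}^{-1}\cdots\sigma_1^{-1}\rho_1,\qquad b=\sigma_{n-2}^{-1}\cdots\sigma_1^{-1}\rho_1,$$ and the half twist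 $$\Delta=(\sigma_1\cdots\sigma_{n-1})(\sigma_1\cdots\sigma_{n-2})\cdots(\sigma_1\sigma_2)\,\sigma_1$$ of this group. For $m\geq 2$, let $\mathrm{Dic}_{4m}=\langle x,y\mid x^m=y^2,\ yxy^{-1}=x^{-1}\rangle$ be the dicyclic group of order $4m$. Then: (a) the subgroup $\langle a,\Delta\rangle$ of $B_n(\mathbb{R}P^2)$ is isomorphic to $\mathrm{Dic}_{8n}$; (b) the subgroup $\langle b,\Delta a^{-1}\rangle$ of $B_n(\mathbb{R}P^2)$ is isomorphic to $\mathrm{Dic}_{8(n-1)}$. -/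

import Mathlib

/-- The generators `σ_1, …, σ_{n-1}, ρ_1, …, ρ_n` of Van Buskirk's presentation of the braid group
`B_n(ℝP²)` of the real projective plane, indexed from `1` as is customary. -/
inductive VanBuskirkGen (n : ℕ) : Type
  | sigma (i : ℕ) (one_le : 1 ≤ i) (lt : i < n) : VanBuskirkGen n
  | rho (j : ℕ) (one_le : 1 ≤ j) (le : j ≤ n) : VanBuskirkGen n

section Words

variable {G : Type*} [Group G]

/-- The ascending word `s 1 * s 2 * ⋯ * s k`. -/
def ascWord (s : ℕ → G) : ℕ → G
  | 0 => 1
  | k + 1 => ascWord s k * s (k + 1)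

/-- The descending word `s k * ⋯ * s 2 * s 1`. -/
def descWord (s : ℕ → G) : ℕ → G
  | 0 => 1
  | k + 1 => s (k + 1) * descWord s k

/-- The word `(s 1 ⋯ s k) (s 1 ⋯ s (k-1)) ⋯ (s 1 s 2) (s 1)`. -/
def halfTwistWord (s : ℕ → G) : ℕ → G
  | 0 => 1
  | k + 1 => ascWord s (k + 1) * halfTwistWord s k

end Words

/-- The letter `σ_i` of the free group on the generators (and `1` for `i` outside `1, …, n-1`; such
`i` do not occur in the relations and words below when `2 ≤ n`). -/
def freeSigma (n i : ℕ) : FreeGroup (VanBuskirkGen n) :=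
  if h : 1 ≤ i ∧ i < n then FreeGroup.of (VanBuskirkGen.sigma i h.1 h.2) else 1

/-- The letter `ρ_j` of the free group on the generators (and `1` for `j` outside `1, …, n`; such
`j` do not occur in the relations and words below when `2 ≤ n`). -/
def freeRho (n j : ℕ) : FreeGroup (VanBuskirkGen n) :=
  if h : 1 ≤ j ∧ j ≤ n then FreeGroup.of (VanBuskirkGen.rho j h.1 h.2) else 1

/-- The relators of Van Buskirk's presentation of `B_n(ℝP²)`. A relation `u = v` is recorded as the
relator `u * v⁻¹`. -/
inductive VanBuskirkRel (n : ℕ) : FreeGroup (VanBuskirkGen n) → Prop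
  /-- `σ_i σ_j = σ_j σ_i` for `|i - j| ≥ 2` -/
  | sigma_comm (i j : ℕ) (hi : 1 ≤ i) (hij : i + 2 ≤ j) (hj : j < n) :
      VanBuskirkRel n
        ((freeSigma n i * freeSigma n j) * (freeSigma n j * freeSigma n i)⁻¹)
  /-- `σ_i σ_{i+1} σ_i = σ_{i+1} σ_i σ_{i+1}` for `1 ≤ i ≤ n - 2` -/
  | braid (i : ℕ) (hi : 1 ≤ i) (hin : i + 1 < n) :
      VanBuskirkRel n
        ((freeSigma n i * freeSigma n (i + 1) * freeSigma n i) *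
          (freeSigma n (i + 1) * freeSigma n i * freeSigma n (i + 1))⁻¹)
  /-- `σ_i ρ_j = ρ_j σ_i` for `j ≠ i, i + 1` -/
  | sigma_rho_comm (i j : ℕ) (hi : 1 ≤ i) (hin : i < n) (hj : 1 ≤ j) (hjn : j ≤ n)
      (hji : j ≠ i) (hji' : j ≠ i + 1) :
      VanBuskirkRel n
        ((freeSigma n i * freeRho n j) * (freeRho n j * freeSigma n i)⁻¹)
  /-- `ρ_{i+1} = σ_i⁻¹ ρ_i σ_i⁻¹` for `1 ≤ i ≤ n - 1` -/
  | rho_succ (i : ℕ) (hi : 1 ≤ i) (hin : i < n) :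
      VanBuskirkRel n
        (freeRho n (i + 1) * ((freeSigma n i)⁻¹ * freeRho n i * (freeSigma n i)⁻¹)⁻¹)
  /-- `ρ_{i+1}⁻¹ ρ_i⁻¹ ρ_{i+1} ρ_i = σ_i²` for `1 ≤ i ≤ n - 1` -/
  | rho_commutator (i : ℕ) (hi : 1 ≤ i) (hin : i < n) :
      VanBuskirkRel n
        (((freeRho n (i + 1))⁻¹ * (freeRho n i)⁻¹ * freeRho n (i + 1) * freeRho n i) *
          (freeSigma n i ^ 2)⁻¹)
  /-- `ρ_1² = σ_1 σ_2 ⋯ σ_{n-2} σ_{n-1}² σ_{n-2} ⋯ σ_2 σ_1` -/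
  | rho_one_sq :
      VanBuskirkRel n
        (freeRho n 1 ^ 2 *
          (ascWord (freeSigma n) (n - 2) * freeSigma n (n - 1) ^ 2 *
            descWord (freeSigma n) (n - 2))⁻¹)

/-- The braid group `B_n(ℝP²)` of the real projective plane on `n` strings, given by Van Buskirk's
presentation. -/
abbrev BraidGroupRP2 (n : ℕ) : Type :=
  PresentedGroup {r : FreeGroup (VanBuskirkGen n) | VanBuskirkRel n r}

namespace BraidGroupRP2

/-- The element `σ_i` of `B_n(ℝP²)`, for `1 ≤ i ≤ n - 1`. -/
def sigma (n i : ℕ) : BraidGroupRP2 n :=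
  PresentedGroup.mk _ (freeSigma n i)

/-- The element `ρ_j` of `B_n(ℝP²)`, for `1 ≤ j ≤ n`. -/
def rho (n j : ℕ) : BraidGroupRP2 n :=
  PresentedGroup.mk _ (freeRho n j)

/-- `a = σ_{n-1}⁻¹ ⋯ σ_1⁻¹ ρ_1`. -/
def a (n : ℕ) : BraidGroupRP2 n :=
  descWord (fun i => (sigma n i)⁻¹) (n - 1) * rho n 1

/-- `b = σ_{n-2}⁻¹ ⋯ σ_1⁻¹ ρ_1`. -/
def b (n : ℕ) : BraidGroupRP2 n :=
  descWord (fun i => (sigma n i)⁻¹) (n - 2) * rho n 1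

/-- The half twist `Δ = (σ_1 ⋯ σ_{n-1}) (σ_1 ⋯ σ_{n-2}) ⋯ (σ_1 σ_2) σ_1`. -/
def halfTwist (n : ℕ) : BraidGroupRP2 n :=
  halfTwistWord (sigma n) (n - 1)

end BraidGroupRP2

/-! Write T_m = (σ_1⋯σ_m)⁻¹ρ_1, so that a = T_{n-1} and b = T_{n-2} = σ_{n-1}a. Conjugation by T_m
lowers the indices of σ_2, …, σ_m, and telescoping gives T_m^{m+1} = ρ_{m+1}⋯ρ_1. Conjugation by a
also sends ρ_{j+1} to ρ_j and ρ_1 to ρ_n⁻¹, so a^n inverts every ρ_j. Comparing the words for a^n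
and for the full twist yields Δ² = a^{2n}, while Δ inverts a. Hence a^{2n} is both fixed and
inverted by Δ, and a^{4n} = 1. Since a^n = ρ_n b^{n-1}, also b^{2(n-1)} = a^{2n}; and Δa⁻¹ inverts b
and has square Δ². So both pairs satisfy the dicyclic relations.

It remains to see that a and b have full orders 4n and 4(n-1). This is detected by an explicit
action that records the positions of two strings and the braid they form in B_2(ℝP²), the dicyclic
group of order 16. The rotation of positions makes the order a multiple of n, respectively n-1. On
the pair (1, 2) the element a^{2n} acts as (ρ_2ρ_1)² ≠ 1, so the common element a^{2n} = b^{2(n-1)}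
is nontrivial. -/

/-! ### Words in a group and telescoping under an index shift -/

section Words

variable {G : Type*} [Group G]

theorem commute_ascWord {x : G} {s : ℕ → G} {k : ℕ}
    (h : ∀ i, 1 ≤ i → i ≤ k → Commute x (s i)) : Commute x (ascWord s k) := by
  induction k with
  | zero => exact Commute.one_right x
  | succ k ih => exact (ih fun i h1 h2 => h i h1 (by omega)).mul_right (h _ (by omega) le_rfl)

theorem commute_descWord {x : G} {s : ℕ → G} {k : ℕ}
    (h : ∀ i, 1 ≤ i → i ≤ k → Commute x (s i)) : Commute x (descWord s k) := by
  induction k with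
  | zero => exact Commute.one_right x
  | succ k ih => exact (h _ (by omega) le_rfl).mul_right (ih fun i h1 h2 => h i h1 (by omega))

theorem commute_halfTwistWord {x : G} {s : ℕ → G} {k : ℕ}
    (h : ∀ i, 1 ≤ i → i ≤ k → Commute x (s i)) : Commute x (halfTwistWord s k) := by
  induction k with
  | zero => exact Commute.one_right x
  | succ k ih => exact (commute_ascWord h).mul_right (ih fun i h1 h2 => h i h1 (by omega))

theorem descWord_inv (s : ℕ → G) (k : ℕ) :
    descWord (fun i => (s i)⁻¹) k = (ascWord s k)⁻¹ := by
  induction k with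
  | zero => simp [descWord, ascWord]
  | succ k ih => simp [descWord, ascWord, ih]

theorem semiconjBy_ascWord {x : G} {s t : ℕ → G} {k : ℕ}
    (h : ∀ i, 1 ≤ i → i ≤ k → SemiconjBy x (s i) (t i)) :
    SemiconjBy x (ascWord s k) (ascWord t k) := by
  induction k with
  | zero => exact SemiconjBy.one_right x
  | succ k ih => exact (ih fun i h1 h2 => h i h1 (by omega)).mul_right (h _ (by omega) le_rfl)

theorem semiconjBy_descWord {x : G} {s t : ℕ → G} {k : ℕ}
    (h : ∀ i, 1 ≤ i → i ≤ k → SemiconjBy x (s i) (t i)) :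
    SemiconjBy x (descWord s k) (descWord t k) := by
  induction k with
  | zero => exact SemiconjBy.one_right x
  | succ k ih => exact (h _ (by omega) le_rfl).mul_right (ih fun i h1 h2 => h i h1 (by omega))

theorem ascWord_succ_eq_mul (s : ℕ → G) (k : ℕ) :
    ascWord s (k + 1) = s 1 * ascWord (fun i => s (i + 1)) k := by
  induction k with
  | zero => simp [ascWord]
  | succ k ih => rw [ascWord, ih, mul_assoc]; rfl

theorem ascWord_reverse (s : ℕ → G) (k : ℕ) :
    ascWord (fun i => s (k + 1 - i)) k = descWord s k := by
  induction k with
  | zero => rfl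
  | succ k ih =>
    rw [ascWord_succ_eq_mul, descWord, ← ih]
    simp

/-- If conjugation by `g` lowers the indices `2, …, m`, then `g ^ t` carries `s m` to
`s (m - t)`. -/
theorem semiconjBy_pow_of_shift {g : G} {s : ℕ → G} {m : ℕ}
    (h : ∀ i, 1 ≤ i → i < m → SemiconjBy g (s (i + 1)) (s i)) (t : ℕ) (ht : t < m) :
    SemiconjBy (g ^ t) (s m) (s (m - t)) := by
  induction t with
  | zero => simp
  | succ t ih =>
    have h1 := h (m - (t + 1)) (by omega) (by omega)
    rw [show m - (t + 1) + 1 = m - t by omega] at h1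
    rw [pow_succ']
    exact h1.mul_left (ih (by omega))

/-- Distributing the powers of g among the letters turns each of them into s m. This telescoping
drives all the power computations below. -/
theorem descWord_mul_pow_of_shift {g : G} {s : ℕ → G} {m : ℕ}
    (h : ∀ i, 1 ≤ i → i < m → SemiconjBy g (s (i + 1)) (s i)) :
    descWord s m * g ^ m = (s m * g) ^ m := by
  have key : ∀ i ≤ m, descWord s i * g ^ m = g ^ (m - i) * (s m * g) ^ i := by
    intro i
    induction i with
    | zero => simp [descWord]
    | succ i ih =>
      intro hi
      -- The power g^(m-(i+1)) is exactly what carries s m to the next letter s (i+1).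
      have h1 := semiconjBy_pow_of_shift h (m - (i + 1)) (by omega)
      rw [show m - (m - (i + 1)) = i + 1 by omega] at h1
      calc descWord s (i + 1) * g ^ m = s (i + 1) * (descWord s i * g ^ m) := by
            rw [descWord, mul_assoc]
        _ = s (i + 1) * g ^ (m - (i + 1)) * (g * (s m * g) ^ i) := by
            rw [ih (by omega), show m - i = m - (i + 1) + 1 by omega, pow_succ]
            simp only [mul_assoc]
        _ = g ^ (m - (i + 1)) * (s m * g) ^ (i + 1) := by
            rw [← h1.eq, pow_succ' (s m * g)]
            simp only [mul_assoc]
  simpa using key m le_rfl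

end Words

/-! ### Artin relations and the half twist -/

/-- The relations of the Artin braid group on `n` strings. -/
structure IsArtinSystem {G : Type*} [Group G] (n : ℕ) (s : ℕ → G) : Prop where
  sigma_comm : ∀ i j, 1 ≤ i → i + 2 ≤ j → j < n → Commute (s i) (s j)
  braid : ∀ i, 1 ≤ i → i + 1 < n → s i * s (i + 1) * s i = s (i + 1) * s i * s (i + 1)

namespace IsArtinSystem

variable {G : Type*} [Group G] {n : ℕ} {s : ℕ → G}

theorem semiconjBy_ascWord (h : IsArtinSystem n s) {k : ℕ} (hk : k < n) (i : ℕ) (h1 : 1 ≤ i)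
    (hi : i < k) : SemiconjBy (ascWord s k) (s i) (s (i + 1)) := by
  induction k with
  | zero => omega
  | succ k ih =>
    rcases Nat.lt_succ_iff_lt_or_eq.mp hi with hik | rfl
    · exact (ih (by omega) hik).mul_left (h.sigma_comm i (k + 1) h1 (by omega) hk).symm
    · obtain ⟨m, rfl⟩ : ∃ m, i = m + 1 := ⟨i - 1, by omega⟩
      have hc : Commute (s (m + 1 + 1)) (ascWord s m) :=
        commute_ascWord fun j hj1 hj2 => (h.sigma_comm j _ hj1 (by omega) hk).symm
      change ascWord s m * s (m + 1) * s (m + 1 + 1) * s (m + 1) =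
        s (m + 1 + 1) * (ascWord s m * s (m + 1) * s (m + 1 + 1))
      calc _ = ascWord s m * (s (m + 1) * s (m + 1 + 1) * s (m + 1)) := by
            simp only [mul_assoc]
        _ = ascWord s m * s (m + 1 + 1) * (s (m + 1) * s (m + 1 + 1)) := by
            rw [h.braid _ (by omega) hk]; simp only [mul_assoc]
        _ = _ := by rw [← hc.eq]; simp only [mul_assoc]

theorem semiconjBy_descWord (h : IsArtinSystem n s) {k : ℕ} (hk : k < n) (i : ℕ) (h1 : 1 ≤ i)
    (hi : i < k) : SemiconjBy (descWord s k) (s (i + 1)) (s i) := by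
  induction k with
  | zero => omega
  | succ k ih =>
    rcases Nat.lt_succ_iff_lt_or_eq.mp hi with hik | rfl
    · have hc : SemiconjBy (s (k + 1)) (s i) (s i) :=
        (h.sigma_comm i (k + 1) h1 (by omega) hk).symm
      exact hc.mul_left (ih (by omega) hik)
    · obtain ⟨m, rfl⟩ : ∃ m, i = m + 1 := ⟨i - 1, by omega⟩
      have hc : Commute (s (m + 1 + 1)) (descWord s m) :=
        commute_descWord fun j hj1 hj2 => (h.sigma_comm j _ hj1 (by omega) hk).symm
      change s (m + 1 + 1) * (s (m + 1) * descWord s m) * s (m + 1 + 1) =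
        s (m + 1) * (s (m + 1 + 1) * (s (m + 1) * descWord s m))
      calc _ = s (m + 1 + 1) * s (m + 1) * (descWord s m * s (m + 1 + 1)) := by
            simp only [mul_assoc]
        _ = s (m + 1 + 1) * s (m + 1) * s (m + 1 + 1) * descWord s m := by
            rw [← hc.eq]; simp only [mul_assoc]
        _ = _ := by rw [← h.braid _ (by omega) hk]; simp only [mul_assoc]

/-- The definition peels an ascending word off the left; this recursion peels a descending word off
the right. Together they factor the square of the half twist. -/
theorem halfTwistWord_succ (h : IsArtinSystem n s) (k : ℕ) (hk : k + 1 < n) :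
    halfTwistWord s (k + 1) = halfTwistWord s k * descWord s (k + 1) := by
  induction k with
  | zero => simp [halfTwistWord, descWord, ascWord]
  | succ k ih =>
    have hc : Commute (s (k + 1 + 1)) (halfTwistWord s k) :=
      commute_halfTwistWord fun j hj1 hj2 => (h.sigma_comm j _ hj1 (by omega) hk).symm
    calc halfTwistWord s (k + 1 + 1)
        = ascWord s (k + 1) * s (k + 1 + 1) * (halfTwistWord s k * descWord s (k + 1)) := by
          rw [← ih (by omega)]; rfl
      _ = ascWord s (k + 1) * (s (k + 1 + 1) * halfTwistWord s k) * descWord s (k + 1) := by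
          simp only [mul_assoc]
      _ = ascWord s (k + 1) * halfTwistWord s k * (s (k + 1 + 1) * descWord s (k + 1)) := by
          rw [hc.eq]; simp only [mul_assoc]
      _ = _ := rfl

theorem semiconjBy_halfTwistWord (h : IsArtinSystem n s) (k : ℕ) (hk : k < n) (i : ℕ)
    (h1 : 1 ≤ i) (hi : i ≤ k) : SemiconjBy (halfTwistWord s k) (s i) (s (k + 1 - i)) := by
  induction k generalizing i with
  | zero => omega
  | succ k ih =>
    rcases Nat.le_succ_iff.mp hi with hik | rfl
    · have h2 := h.semiconjBy_ascWord hk (k + 1 - i) (by omega) (by omega)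
      rw [show k + 1 - i + 1 = k + 1 + 1 - i by omega] at h2
      exact h2.mul_left (ih (by omega) i h1 hik)
    · rcases Nat.eq_zero_or_pos k with rfl | hkpos
      · simp [halfTwistWord, ascWord, SemiconjBy]
      · rw [h.halfTwistWord_succ k hk]
        have h2 := ih (by omega) k hkpos le_rfl
        rw [show k + 1 - k = k + 1 + 1 - (k + 1) by omega] at h2
        exact h2.mul_left (h.semiconjBy_descWord hk k hkpos (by omega))

theorem halfTwistWord_mul_ascWord (h : IsArtinSystem n s) (k : ℕ) (hk : k < n) :
    SemiconjBy (halfTwistWord s k) (ascWord s k) (descWord s k) := by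
  rw [← ascWord_reverse s k]
  exact _root_.semiconjBy_ascWord fun i h1 hi => h.semiconjBy_halfTwistWord k hk i h1 hi

/-- Write D_k and Δ_k for the descending and half twist words, A_k for the ascending one.
Telescoping with g = D_{k+1} and letters s_i⁻¹ gives D_{k+1}^{k+1} = A_{k+1}Δ_k². One more factor
D_{k+1} completes A_{k+1}Δ_k · Δ_kD_{k+1} = Δ_{k+1}². -/
theorem descWord_pow (h : IsArtinSystem n s) (k : ℕ) (hk : k < n) :
    descWord s k ^ (k + 1) = halfTwistWord s k ^ 2 := by
  induction k with
  | zero => simp [descWord, halfTwistWord]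
  | succ k ih =>
    have h1 := descWord_mul_pow_of_shift (g := descWord s (k + 1)) (s := fun i => (s i)⁻¹)
      (m := k + 1) fun i h1 hi => (h.semiconjBy_descWord hk i h1 hi).inv_right
    have h2 : (s (k + 1))⁻¹ * descWord s (k + 1) = descWord s k := by simp [descWord]
    simp only [h2, descWord_inv] at h1
    rw [ih (by omega), inv_mul_eq_iff_eq_mul] at h1
    rw [pow_succ, h1]
    rw [sq (halfTwistWord s (k + 1))]
    nth_rewrite 2 [h.halfTwistWord_succ k hk]
    simp only [halfTwistWord, sq, mul_assoc]

end IsArtinSystem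

/-! ### Consequences of Van Buskirk's relations -/

/-- Elements of a group subject to Van Buskirk's relations for the braid group of the projective
plane on `n` strings. -/
structure IsVanBuskirkSystem {G : Type*} [Group G] (n : ℕ) (s r : ℕ → G) : Prop
    extends IsArtinSystem n s where
  sigma_rho_comm : ∀ i j, 1 ≤ i → i < n → 1 ≤ j → j ≤ n → j ≠ i → j ≠ i + 1 →
    Commute (s i) (r j)
  sigma_rho_sigma : ∀ i, 1 ≤ i → i < n → s i * r (i + 1) * s i = r i
  rho_mul_rho : ∀ i, 1 ≤ i → i < n → r (i + 1) * r i = r i * r (i + 1) * s i ^ 2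
  rho_one_sq : r 1 ^ 2 = ascWord s (n - 1) * descWord s (n - 1)

/-- The element `s m⁻¹ ⋯ s 1⁻¹ * r 1`. -/
def torsionWord {G : Type*} [Group G] (s r : ℕ → G) (m : ℕ) : G :=
  (ascWord s m)⁻¹ * r 1

namespace IsVanBuskirkSystem

variable {G : Type*} [Group G] {n : ℕ} {s r : ℕ → G}

theorem sigma_mul_rho_mul_rho_mul_sigma (h : IsVanBuskirkSystem n s r) (i : ℕ) (h1 : 1 ≤ i)
    (hi : i < n) : s i * (r (i + 1) * r i) * s i = r (i + 1) * r i := by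
  have h2 := h.sigma_rho_sigma i h1 hi
  calc s i * (r (i + 1) * r i) * s i = s i * r (i + 1) * (s i * r (i + 1) * s i) * s i := by
        rw [h2]; simp only [mul_assoc]
    _ = s i * r (i + 1) * s i * r (i + 1) * s i ^ 2 := by simp only [sq, mul_assoc]
    _ = r (i + 1) * r i := by rw [h2, h.rho_mul_rho i h1 hi]

theorem rho_mul_rho_succ (h : IsVanBuskirkSystem n s r) (i : ℕ) (h1 : 1 ≤ i)
    (hi : i < n) : r i * r (i + 1) = s i * r i * (s i)⁻¹ * r i := by
  have h2 := h.sigma_rho_sigma i h1 hi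
  have h3 := h.sigma_mul_rho_mul_rho_mul_sigma i h1 hi
  have h4 : s i * r i * (s i)⁻¹ * r i = s i * (r i * r (i + 1)) * s i := by
    calc s i * r i * (s i)⁻¹ * r i = s i * r i * (s i)⁻¹ * (s i * r (i + 1) * s i) := by rw [h2]
      _ = _ := by simp [mul_assoc]
  rw [h4]
  apply mul_right_cancel (b := s i ^ 2)
  rw [← h.rho_mul_rho i h1 hi]
  nth_rewrite 1 [← h3]
  rw [h.rho_mul_rho i h1 hi]
  simp only [sq, mul_assoc]

theorem torsionWord_eq_mul_succ (s r : ℕ → G) (m : ℕ) :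
    torsionWord s r m = s (m + 1) * torsionWord s r (m + 1) := by
  simp [torsionWord, ascWord, mul_assoc]

/-- Each relation ρ_i = σ_iρ_{i+1}σ_i cancels one inverse letter on the left and creates one letter
on the right. -/
theorem torsionWord_eq (h : IsVanBuskirkSystem n s r) (m : ℕ) (hm : m < n) :
    torsionWord s r m = r (m + 1) * descWord s m := by
  induction m with
  | zero => simp [torsionWord, ascWord, descWord]
  | succ m ih =>
    have h1 := ih (by omega)
    rw [torsionWord_eq_mul_succ, ← h.sigma_rho_sigma (m + 1) (by omega) hm] at h1
    apply mul_left_cancel (a := s (m + 1))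
    rw [h1, descWord]
    simp only [mul_assoc]

theorem torsionWord_shift (h : IsVanBuskirkSystem n s r) {m : ℕ} (hm : m < n) (i : ℕ)
    (h1 : 1 ≤ i) (hi : i < m) : SemiconjBy (torsionWord s r m) (s (i + 1)) (s i) := by
  have h2 : SemiconjBy (r 1) (s (i + 1)) (s (i + 1)) :=
    (h.sigma_rho_comm (i + 1) 1 (by omega) (by omega) le_rfl (by omega) (by omega)
      (by omega)).symm
  have h3 := (h.toIsArtinSystem.semiconjBy_ascWord hm i h1 hi).inv_symm_left
  exact h3.mul_left h2

/-- Telescoping with g = T_{m+1} and s_{m+1}T_{m+1} = T_m gives (s_{m+1}⋯s_1)T_{m+1}^{m+1} =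
T_m^{m+1}; the remaining factor T_{m+1} = r_{m+2}s_{m+1}⋯s_1 adds one letter. -/
theorem torsionWord_pow (h : IsVanBuskirkSystem n s r) (m : ℕ) (hm : m < n) :
    torsionWord s r m ^ (m + 1) = descWord r (m + 1) := by
  induction m with
  | zero => simp [torsionWord, ascWord, descWord]
  | succ m ih =>
    have h1 := descWord_mul_pow_of_shift (fun i => h.torsionWord_shift hm i)
    rw [← torsionWord_eq_mul_succ, ih (by omega)] at h1
    rw [pow_succ']
    nth_rewrite 1 [h.torsionWord_eq _ hm]
    rw [mul_assoc, h1]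
    rfl

/-! ### Dicyclic relations for a and b -/

section Torsion

variable {N : ℕ}

theorem torsionWord_mul_rho (h : IsVanBuskirkSystem (N + 1) s r) (j : ℕ) (h1 : 1 ≤ j)
    (hj : j < N + 1) : SemiconjBy (torsionWord s r N) (r (j + 1)) (r j) := by
  induction j, h1 using Nat.le_induction with
  | base =>
    -- Only s 1 fails to commute with r 1, so the whole ascending word conjugates r 1 as s 1 does.
    have hasc : ∀ k, k < N → ascWord s (k + 1) * r 1 = s 1 * r 1 * (s 1)⁻¹ * ascWord s (k + 1) := by
      intro k hk
      induction k with
      | zero => simp [ascWord]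
      | succ k ih =>
        have hc := h.sigma_rho_comm (k + 1 + 1) 1 (by omega) (by omega) le_rfl (by omega)
          (by omega) (by omega)
        rw [ascWord, mul_assoc, hc.eq, ← mul_assoc, ih (by omega), mul_assoc]
    have h2 := hasc (N - 1) (by omega)
    rw [Nat.sub_add_cancel (by omega)] at h2
    change torsionWord s r N * r (1 + 1) = r 1 * torsionWord s r N
    apply mul_left_cancel (a := ascWord s N)
    simp only [torsionWord, ← mul_assoc, mul_inv_cancel, one_mul]
    rw [h2, mul_inv_cancel_right, h.rho_mul_rho_succ 1 le_rfl hj]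
  | succ j hj1 ih =>
    have h2 := ih (by omega)
    have h3 := h.torsionWord_shift (Nat.lt_succ_self N) j hj1 (by omega)
    have e : ∀ i, 1 ≤ i → i < N + 1 → r (i + 1) = (s i)⁻¹ * r i * (s i)⁻¹ := fun i hi1 hi2 => by
      rw [← h.sigma_rho_sigma i hi1 hi2]; simp [mul_assoc]
    have h4 := (h3.inv_right.mul_right h2).mul_right h3.inv_right
    rwa [← e (j + 1) (by omega) hj, ← e j hj1 (by omega)] at h4

theorem descWord_eq (h : IsVanBuskirkSystem (N + 1) s r) :
    descWord s N = torsionWord s r N * r 1 := by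
  have h1 := h.rho_one_sq
  simp only [Nat.add_sub_cancel] at h1
  rw [torsionWord, mul_assoc, ← sq, h1, inv_mul_cancel_left]

/-- Combining a = ρ_n(σ_{n-1}⋯σ_1) with σ_{n-1}⋯σ_1 = aρ_1 gives a = ρ_n a ρ_1. -/
theorem torsionWord_mul_rho_one (h : IsVanBuskirkSystem (N + 1) s r) :
    SemiconjBy (torsionWord s r N) (r 1) (r (N + 1))⁻¹ := by
  have h1 := h.torsionWord_eq N (by omega)
  rw [h.descWord_eq] at h1
  rw [SemiconjBy, eq_inv_mul_iff_mul_eq]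
  exact h1.symm

theorem torsionWord_pow_mul_rho (h : IsVanBuskirkSystem (N + 1) s r) (j : ℕ) (h1 : 1 ≤ j)
    (hj : j ≤ N + 1) : SemiconjBy (torsionWord s r N ^ (N + 1)) (r j) (r j)⁻¹ := by
  have hs := semiconjBy_pow_of_shift (m := N + 1) (fun i => h.torsionWord_mul_rho i)
  have h2 := hs N (by omega)
  rw [Nat.add_sub_cancel_left] at h2
  have h3 : SemiconjBy (torsionWord s r N ^ (N + 1)) (r (N + 1)) (r (N + 1))⁻¹ := by
    rw [pow_succ']
    exact h.torsionWord_mul_rho_one.mul_left h2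
  -- A power of a carries ρ_n to ρ_j and commutes with a^n, so the case j = n transfers to every j.
  have h4 := hs (N + 1 - j) (by omega)
  rw [show N + 1 - (N + 1 - j) = j by omega] at h4
  have h5 := (h4.inv_right.mul_left h3).mul_left h4.inv_symm_left
  rwa [← pow_add, add_comm, pow_add, mul_inv_cancel_right] at h5

/-- Since a^n = ρ_n⋯ρ_1 commutes with itself and inverts each letter, a^n = ρ_n⁻¹⋯ρ_1⁻¹. Telescoping
then turns a^n · a^n into (ρ_n⁻¹a)^n = (σ_{n-1}⋯σ_1)^n, the full twist. -/
theorem halfTwistWord_sq (h : IsVanBuskirkSystem (N + 1) s r) :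
    halfTwistWord s N ^ 2 = torsionWord s r N ^ (2 * (N + 1)) := by
  have h1 := semiconjBy_descWord fun j => h.torsionWord_pow_mul_rho j
  rw [← h.torsionWord_pow N (by omega), SemiconjBy, mul_left_inj] at h1
  have h2 := descWord_mul_pow_of_shift (g := torsionWord s r N) (s := fun i => (r i)⁻¹)
    (m := N + 1) fun i h1 hi => (h.torsionWord_mul_rho i h1 hi).inv_right
  rw [← h.toIsArtinSystem.descWord_pow N (by omega), two_mul,
    pow_add (torsionWord s r N)]
  nth_rewrite 1 [h1]
  rw [h2]
  congr 1
  rw [h.torsionWord_eq N (by omega), inv_mul_cancel_left]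

/-- Δ reverses the σ indices and sends ρ_1 to ρ_n⁻¹, so a goes to (ρ_nσ_{n-1}⋯σ_1)⁻¹ = a⁻¹. -/
theorem halfTwistWord_mul_torsionWord (h : IsVanBuskirkSystem (N + 1) s r) :
    SemiconjBy (halfTwistWord s N) (torsionWord s r N) (torsionWord s r N)⁻¹ := by
  have h1 : SemiconjBy (halfTwistWord s N) (r 1) (r (N + 1))⁻¹ := by
    have hd : SemiconjBy (descWord s N) (r 1) (r (N + 1))⁻¹ := by
      rw [h.descWord_eq]
      exact h.torsionWord_mul_rho_one.mul_left rfl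
    rcases Nat.eq_zero_or_pos N with rfl | hN
    · exact hd
    · obtain ⟨M, rfl⟩ : ∃ M, N = M + 1 := ⟨N - 1, by omega⟩
      rw [h.toIsArtinSystem.halfTwistWord_succ M (by omega)]
      refine SemiconjBy.mul_left ?_ hd
      refine SemiconjBy.inv_right (Commute.symm (commute_halfTwistWord fun i hi1 hi2 => ?_))
      exact (h.sigma_rho_comm i _ hi1 (by omega) (by omega) (by omega) (by omega)
        (by omega)).symm
  have h2 := (h.toIsArtinSystem.halfTwistWord_mul_ascWord N (by omega)).inv_right.mul_right h1
  rw [← mul_inv_rev, ← h.torsionWord_eq N (by omega)] at h2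
  exact h2

theorem torsionWord_pow_mul_sigma (h : IsVanBuskirkSystem (N + 2) s r) :
    SemiconjBy (torsionWord s r (N + 1) ^ (N + 2)) (s (N + 1)) (s (N + 1))⁻¹ := by
  rw [h.torsionWord_pow (N + 1) (by omega), SemiconjBy, eq_inv_mul_iff_mul_eq]
  have hc : Commute (s (N + 1)) (descWord r N) := commute_descWord fun i hi1 hi2 =>
    h.sigma_rho_comm _ i (by omega) (by omega) hi1 (by omega) (by omega) (by omega)
  have h3 := h.sigma_mul_rho_mul_rho_mul_sigma (N + 1) (by omega) (by omega)
  calc s (N + 1) * (descWord r (N + 2) * s (N + 1))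
      = s (N + 1) * (r (N + 1 + 1) * r (N + 1)) * (descWord r N * s (N + 1)) := by
        simp only [descWord, mul_assoc]
    _ = descWord r (N + 2) := by
        rw [← hc.eq, ← mul_assoc, h3]; simp only [descWord, mul_assoc]

/-- From a^n = ρ_n b^{n-1}, where a^n inverts ρ_n, also b^{n-1} = a^nρ_n; multiply by b^{n-1}. -/
theorem torsionWord_pow_eq (h : IsVanBuskirkSystem (N + 2) s r) :
    torsionWord s r N ^ (2 * (N + 1)) = torsionWord s r (N + 1) ^ (2 * (N + 2)) := by
  have h1 := h.torsionWord_pow N (by omega)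
  have h2 := h.torsionWord_pow (N + 1) (by omega)
  have h3 := h.torsionWord_pow_mul_rho (N + 2) (by omega) (by omega)
  rw [descWord, ← h1] at h2
  rw [two_mul, two_mul, pow_add _ (N + 1), pow_add _ (N + 2)]
  have h4 := h3.eq
  calc torsionWord s r N ^ (N + 1) * torsionWord s r N ^ (N + 1)
      = (r (N + 2))⁻¹ * torsionWord s r (N + 1) ^ (N + 2) * torsionWord s r N ^ (N + 1) := by
        rw [h2, inv_mul_cancel_left]
    _ = torsionWord s r (N + 1) ^ (N + 2) * (r (N + 2) * torsionWord s r N ^ (N + 1)) := by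
        rw [← h4, mul_assoc]
    _ = _ := by rw [← h2]

theorem torsionWord_pow_eq_one (h : IsVanBuskirkSystem (N + 1) s r) :
    torsionWord s r N ^ (4 * (N + 1)) = 1 := by
  have h1 := h.halfTwistWord_mul_torsionWord.pow_right (2 * (N + 1))
  rw [← h.halfTwistWord_sq, inv_pow, ← h.halfTwistWord_sq] at h1
  have h2 : halfTwistWord s N ^ 2 = (halfTwistWord s N ^ 2)⁻¹ := by
    apply mul_right_cancel (b := halfTwistWord s N)
    rw [← h1.eq, ← pow_succ, ← pow_succ']
  rw [show 4 * (N + 1) = 2 * (N + 1) + 2 * (N + 1) by ring, pow_add, ← h.halfTwistWord_sq]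
  nth_rewrite 1 [h2]
  exact inv_mul_cancel _

/-- The element `Δ a⁻¹` inverts `b` under conjugation. -/
theorem halfTwistWord_mul_inv_mul (h : IsVanBuskirkSystem (N + 2) s r) :
    SemiconjBy (halfTwistWord s (N + 1) * (torsionWord s r (N + 1))⁻¹) (torsionWord s r N)
      (torsionWord s r N)⁻¹ := by
  set A := torsionWord s r (N + 1) with hA
  set D := halfTwistWord s (N + 1) with hD
  have h1 : D * A⁻¹ = A * D := by
    have := h.halfTwistWord_mul_torsionWord.inv_right.eq
    rwa [inv_inv] at this
  have h2 : SemiconjBy D (s 1) (s (N + 1)) := by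
    have := h.toIsArtinSystem.semiconjBy_halfTwistWord (N + 1) (by omega) 1 le_rfl (by omega)
    rwa [Nat.add_sub_cancel] at this
  -- A^N carries σ_{N+1} to σ_1 and A^{N+2} inverts σ_{N+1}; the quotient is A².
  have h3 : SemiconjBy (A ^ 2) (s 1) (s (N + 1))⁻¹ := by
    have h4 := semiconjBy_pow_of_shift (fun i => h.torsionWord_shift (m := N + 1) (by omega) i) N
      (by omega)
    rw [Nat.add_sub_cancel_left] at h4
    have h5 := h.torsionWord_pow_mul_sigma.mul_left h4.inv_symm_left
    rwa [← hA, show N + 2 = 2 + N by ring, pow_add, mul_inv_cancel_right] at h5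
  have h6 : s 1 * (A ^ 2)⁻¹ * s (N + 1) * A ^ 2 = 1 := by
    have h7 := h3.inv_symm_left.eq
    rw [← h7]
    simp
  rw [torsionWord_eq_mul_succ, ← hA, SemiconjBy, eq_inv_mul_iff_mul_eq]
  calc s (N + 1) * A * (D * A⁻¹ * (s (N + 1) * A))
      = s (N + 1) * (A * D) * A⁻¹ * s (N + 1) * A := by simp only [mul_assoc]
    _ = s (N + 1) * D * A⁻¹ * A⁻¹ * s (N + 1) * A := by rw [← h1]; simp only [mul_assoc]
    _ = D * (s 1 * (A ^ 2)⁻¹ * s (N + 1) * A ^ 2) * A⁻¹ := by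
        rw [← h2.eq, sq]; simp only [mul_assoc, mul_inv_rev, mul_inv_cancel, mul_one]
    _ = D * A⁻¹ := by rw [h6, mul_one]

theorem halfTwistWord_mul_inv_sq (h : IsVanBuskirkSystem (N + 1) s r) :
    (halfTwistWord s N * (torsionWord s r N)⁻¹) ^ 2 = torsionWord s r N ^ (2 * (N + 1)) := by
  have h1 := h.halfTwistWord_mul_torsionWord.inv_right.eq
  rw [inv_inv] at h1
  rw [← h.halfTwistWord_sq, sq, sq]
  nth_rewrite 2 [h1]
  simp [mul_assoc]

end Torsion

end IsVanBuskirkSystem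

/-! ### Recognising dicyclic groups and computing orders -/

/-- A subgroup generated by elements satisfying the dicyclic relations, the first of full order,
is dicyclic. -/
theorem nonempty_closure_mulEquiv_quaternionGroup {G : Type*} [Group G] {x y : G} {m : ℕ}
    (hm : 2 ≤ m) (hx : orderOf x = 2 * m) (hyx : SemiconjBy y x x⁻¹) (hy : y ^ 2 = x ^ m) :
    Nonempty (Subgroup.closure {x, y} ≃* QuaternionGroup m) := by
  have : NeZero (2 * m) := ⟨by omega⟩
  have hx1 : x ^ (2 * m) = 1 := hx ▸ pow_orderOf_eq_one x
  let e : ZMod (2 * m) → G := fun i => x ^ i.val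
  have ecast : ∀ k : ℕ, e k = x ^ k := fun k => by
    simp only [e, ZMod.val_natCast]
    rw [← hx, pow_mod_orderOf]
  have eadd : ∀ i j, e (i + j) = e i * e j := fun i j => by
    rw [← ZMod.natCast_zmod_val i, ← ZMod.natCast_zmod_val j, ← Nat.cast_add, ecast, ecast, ecast,
      pow_add]
  have e0 : e 0 = 1 := by simp [e]
  have eneg : ∀ i, e (-i) = (e i)⁻¹ := fun i => by
    rw [eq_inv_iff_mul_eq_one, ← eadd, neg_add_cancel, e0]
  have esub : ∀ i j, e (i - j) = e i * (e j)⁻¹ := fun i j => by rw [sub_eq_add_neg, eadd, eneg]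
  have ey : ∀ i, e i * y = y * (e i)⁻¹ := fun i => by
    have := (hyx.pow_right i.val).inv_right.eq
    simp only [inv_pow, inv_inv] at this
    exact this.symm
  have ecomm : ∀ i j, e i * e j = e j * e i := fun i j => by rw [← eadd, add_comm, eadd]
  have ecomm' : ∀ i j, (e i)⁻¹ * e j = e j * (e i)⁻¹ := fun i j => by rw [← eneg, ecomm]
  let f : QuaternionGroup m →* G :=
    { toFun := fun q => match q with
        | .a i => e i
        | .xa i => y * e i
      map_one' := e0
      map_mul' := by
        rintro (i | i) (j | j)
        · exact eadd i j
        · change y * e (j - i) = e i * (y * e j)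
          rw [← mul_assoc, ey, mul_assoc, ecomm', esub]
        · change y * e (i + j) = y * e i * e j
          rw [eadd, mul_assoc]
        · change e (m + j - i) = y * e i * (y * e j)
          rw [mul_assoc, ← mul_assoc (e i), ey, esub, eadd, ecast, ← hy, mul_assoc, ← ecomm', sq]
          simp only [mul_assoc] }
  have hdvd : ∀ k, x ^ k = 1 → 2 * m ∣ k := fun k hk => hx ▸ orderOf_dvd_of_pow_eq_one hk
  have hinj : Function.Injective f := by
    rw [injective_iff_map_eq_one]
    rintro (i | i) hi
    · change x ^ i.val = 1 at hi
      have h1 := Nat.eq_zero_of_dvd_of_lt (hdvd _ hi) (ZMod.val_lt i)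
      rw [(ZMod.val_eq_zero i).mp h1, QuaternionGroup.one_def]
    -- Here y would be a power of x, so inverting x would force x² = 1, against the order 2m ≥ 4.
    · change y * x ^ i.val = 1 at hi
      have h1 : y = (x ^ i.val)⁻¹ := eq_inv_of_mul_eq_one_left hi
      have h2 : y * x = x * y := by
        rw [h1]; exact ((Commute.refl x).pow_left _).inv_left.eq
      have h3 : x = x⁻¹ := mul_right_cancel (h2.symm.trans hyx.eq)
      have h4 : x ^ 2 = 1 := by rw [sq]; nth_rewrite 1 [h3]; simp
      have := Nat.le_of_dvd two_pos (hdvd _ h4)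
      omega
  have hrange : f.range = Subgroup.closure {x, y} := by
    apply le_antisymm
    · rintro _ ⟨i | i, rfl⟩
      · exact pow_mem (Subgroup.subset_closure (by simp)) _
      · exact mul_mem (Subgroup.subset_closure (by simp))
          (pow_mem (Subgroup.subset_closure (by simp)) _)
    · rw [Subgroup.closure_le]
      rintro g (rfl | rfl)
      · refine ⟨.a 1, ?_⟩
        change e 1 = _
        simpa using ecast 1
      · refine ⟨.xa 0, ?_⟩
        change _ * e 0 = _
        rw [e0, mul_one]
  exact ⟨((MonoidHom.ofInjective hinj).trans (MulEquiv.subgroupCongr hrange)).symm⟩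

/-- A permutation that rotates a position among `1, …, k` has order divisible by `k`. -/
theorem dvd_of_pow_eq_one_of_rotation {X : Type*} {g : Equiv.Perm X} {pos : X → ℕ} {k : ℕ}
    (hk : 1 ≤ k) (hstep : ∀ x, 2 ≤ pos x → pos x ≤ k → pos (g x) = pos x - 1)
    (hwrap : ∀ x, pos x = 1 → pos (g x) = k) {x : X} (hx : pos x = k) {e : ℕ} (he : g ^ e = 1) :
    k ∣ e := by
  -- Position plus elapsed time is invariant modulo k.
  have key : ∀ t, 1 ≤ pos ((g ^ t) x) ∧ pos ((g ^ t) x) ≤ k ∧ k ∣ pos ((g ^ t) x) + t := by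
    intro t
    induction t with
    | zero => simp [hx, hk]
    | succ t ih =>
      obtain ⟨h1, h2, h3⟩ := ih
      rw [pow_succ', Equiv.Perm.mul_apply]
      rcases Nat.eq_or_lt_of_le h1 with h | h
      · rw [← h] at h3
        rw [hwrap _ h.symm]
        refine ⟨hk, le_rfl, (Nat.dvd_add_right dvd_rfl).mpr ?_⟩
        rwa [add_comm]
      · rw [hstep _ h h2]
        refine ⟨by omega, by omega, ?_⟩
        rwa [show pos ((g ^ t) x) - 1 + (t + 1) = pos ((g ^ t) x) + t by omega]
  have h1 := (key e).2.2
  rw [he, Equiv.Perm.one_apply, hx] at h1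
  exact (Nat.dvd_add_right dvd_rfl).mp h1

theorem orderOf_eq_four_mul {G : Type*} [Group G] {x : G} {k : ℕ}
    (h1 : x ^ (4 * k) = 1) (h2 : x ^ (2 * k) ≠ 1) (h3 : ∀ e, x ^ e = 1 → k ∣ e) :
    orderOf x = 4 * k := by
  obtain ⟨c, hc⟩ := h3 _ (pow_orderOf_eq_one x)
  have hk : 0 < k := by
    rcases Nat.eq_zero_or_pos k with rfl | h
    · simp at h2
    · exact h
  have h4 : c ∣ 4 := by
    have := orderOf_dvd_of_pow_eq_one h1
    rw [hc, mul_comm 4] at this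
    exact Nat.dvd_of_mul_dvd_mul_left hk this
  have h5 : ¬ c ∣ 2 := fun h => h2 <| by
    rw [← orderOf_dvd_iff_pow_eq_one, hc, mul_comm 2]
    exact Nat.mul_dvd_mul_left k h
  have h6 : c ≤ 4 := Nat.le_of_dvd (by norm_num) h4
  have h7 : c = 4 := by interval_cases c <;> omega
  rw [hc, h7, mul_comm]

/-! ### The action on pairs of strings -/

namespace PairModel

/-- The group `B_2(ℝP²)`, which is dicyclic of order `16`. -/
abbrev Fiber : Type := QuaternionGroup 4

/-- The positions of two strings together with a braid on two strings. -/
abbrev State : Type := (ℕ × ℕ) × Fiber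

abbrev sigmaTwo : Fiber := .xa 0

abbrev rhoOne : Fiber := .xa 1

abbrev rhoTwo : Fiber := .xa 3

/-- The braid on two strings that `σ_i` induces on the strings at a pair of positions. -/
def sigmaLabel (i : ℕ) (p : ℕ × ℕ) : Fiber :=
  if (p.1 = i ∧ p.2 = i + 1) ∨ (p.1 = i + 1 ∧ p.2 = i) then sigmaTwo else 1

/-- The braid on two strings that `ρ_j` induces on the strings at a pair of positions among
`1, …, n`. -/
def rhoLabel (n j : ℕ) (p : ℕ × ℕ) : Fiber :=
  if (p.1 = j ∧ j < p.2 ∧ p.2 ≤ n) ∨ (p.2 = j ∧ j < p.1 ∧ p.1 ≤ n) then rhoOne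
  else if (p.1 = j ∧ 1 ≤ p.2 ∧ p.2 < j) ∨ (p.2 = j ∧ 1 ≤ p.1 ∧ p.1 < j) then rhoTwo
  else 1

/-- The action of `σ_i` on pairs of strings. -/
def sigma (i : ℕ) : Equiv.Perm State :=
  Equiv.prodShear ((Equiv.swap i (i + 1)).prodCongr (Equiv.swap i (i + 1)))
    fun p => Equiv.mulLeft (sigmaLabel i p)

/-- Left multiplication of the fibres by the values of `w`. -/
def fiberMul (w : ℕ × ℕ → Fiber) : Equiv.Perm State :=
  Equiv.prodShear (Equiv.refl _) fun p => Equiv.mulLeft (w p)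

/-- The action of `ρ_j` on pairs of strings at positions among `1, …, n`. -/
def rho (n j : ℕ) : Equiv.Perm State := fiberMul (rhoLabel n j)

theorem sigma_apply (i j k : ℕ) (h : Fiber) : sigma i ((j, k), h) =
    ((Equiv.swap i (i + 1) j, Equiv.swap i (i + 1) k), sigmaLabel i (j, k) * h) := rfl

theorem fiberMul_apply (w : ℕ × ℕ → Fiber) (p : ℕ × ℕ) (h : Fiber) :
    fiberMul w (p, h) = (p, w p * h) := rfl

theorem rho_apply (n i j k : ℕ) (h : Fiber) : rho n i ((j, k), h) =
    ((j, k), rhoLabel n i (j, k) * h) := rfl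

/-- This and the later relations are checked pointwise: a case split on the two positions leaves at
most an identity in the fibre, decided separately where needed. -/
theorem sigma_comm (i j : ℕ) (hij : i + 2 ≤ j) : Commute (sigma i) (sigma j) := by
  ext1 ⟨⟨p, q⟩, h⟩
  simp only [Equiv.Perm.mul_apply, sigma_apply, Equiv.swap_apply_def, sigmaLabel]
  grind (splits := 40)

theorem braid (i : ℕ) : sigma i * sigma (i + 1) * sigma i =
    sigma (i + 1) * sigma i * sigma (i + 1) := by
  ext1 ⟨⟨p, q⟩, h⟩
  simp only [Equiv.Perm.mul_apply, sigma_apply, Equiv.swap_apply_def, sigmaLabel]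
  grind (splits := 40)

theorem sigma_rho_comm (n i j : ℕ) (h1 : 1 ≤ i) (hi : i < n) (hij : j ≠ i) (hij' : j ≠ i + 1) :
    Commute (sigma i) (rho n j) := by
  ext1 ⟨⟨p, q⟩, h⟩
  simp only [Equiv.Perm.mul_apply, sigma_apply, rho_apply, Equiv.swap_apply_def, sigmaLabel,
    rhoLabel]
  grind (splits := 40)

theorem sigmaTwo_mul_rhoTwo : sigmaTwo * (rhoTwo * sigmaTwo) = rhoOne := by decide

theorem sigma_rho_sigma (n i : ℕ) (h1 : 1 ≤ i) (hi : i < n) :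
    sigma i * rho n (i + 1) * sigma i = rho n i := by
  ext1 ⟨⟨p, q⟩, h⟩
  have := sigmaTwo_mul_rhoTwo
  simp only [Equiv.Perm.mul_apply, sigma_apply, rho_apply, Equiv.swap_apply_def, sigmaLabel,
    rhoLabel]
  grind (splits := 40)

theorem rhoTwo_mul_rhoOne : rhoTwo * rhoOne = rhoOne * (rhoTwo * (sigmaTwo * sigmaTwo)) := by
  decide

theorem rho_mul_rho (n i : ℕ) (h1 : 1 ≤ i) (hi : i < n) :
    rho n (i + 1) * rho n i = rho n i * rho n (i + 1) * sigma i ^ 2 := by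
  ext1 ⟨⟨p, q⟩, h⟩
  have := rhoTwo_mul_rhoOne
  simp only [sq, Equiv.Perm.mul_apply, sigma_apply, rho_apply, Equiv.swap_apply_def, sigmaLabel,
    rhoLabel]
  grind (splits := 40)

/-- The braid that the string at position `l` passing once around the strings at positions
`l + 1, …, n` induces on the strings at a pair of positions. -/
def loopLabel (n l : ℕ) (p : ℕ × ℕ) : Fiber :=
  if (p.1 = l ∧ l < p.2 ∧ p.2 ≤ n) ∨ (p.2 = l ∧ l < p.1 ∧ p.1 ≤ n) then sigmaTwo * sigmaTwo else 1

/-- Iterated from the trivial loop at position n, this evaluates the right side of the relation for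
ρ_1². -/
theorem sigma_loop_sigma (n l : ℕ) (hl : l < n) :
    sigma l * fiberMul (loopLabel n (l + 1)) * sigma l = fiberMul (loopLabel n l) := by
  ext1 ⟨⟨p, q⟩, h⟩
  simp only [Equiv.Perm.mul_apply, sigma_apply, fiberMul_apply, Equiv.swap_apply_def, sigmaLabel,
    loopLabel]
  grind (splits := 40)

theorem ascWord_loop_descWord (n m : ℕ) (hm : m < n) :
    ascWord sigma m * fiberMul (loopLabel n (m + 1)) * descWord sigma m =
      fiberMul (loopLabel n 1) := by
  induction m with
  | zero => simp [ascWord, descWord]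
  | succ m ih =>
    rw [← ih (by omega), ← sigma_loop_sigma n (m + 1) hm]
    simp only [ascWord, descWord, mul_assoc]

theorem rho_one_sq (n : ℕ) (hn : 2 ≤ n) :
    rho n 1 ^ 2 = ascWord sigma (n - 1) * descWord sigma (n - 1) := by
  have h1 : fiberMul (loopLabel n (n - 1 + 1)) = 1 := by
    ext1 ⟨⟨p, q⟩, h⟩
    simp only [fiberMul_apply, loopLabel, Equiv.Perm.one_apply]
    grind
  have h2 := ascWord_loop_descWord n (n - 1) (by omega)
  rw [h1, mul_one] at h2
  rw [h2]
  have hr : rhoOne * rhoOne = sigmaTwo * sigmaTwo := by decide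
  ext1 ⟨⟨p, q⟩, h⟩
  simp only [sq, Equiv.Perm.mul_apply, fiberMul_apply, rho_apply, rhoLabel, loopLabel]
  grind (splits := 40)

theorem isVanBuskirkSystem (n : ℕ) (hn : 2 ≤ n) : IsVanBuskirkSystem n sigma (rho n) where
  sigma_comm i j _ hij _ := sigma_comm i j hij
  braid i _ _ := braid i
  sigma_rho_comm i j h1 hi _ _ hij hij' := sigma_rho_comm n i j h1 hi hij hij'
  sigma_rho_sigma i h1 hi := sigma_rho_sigma n i h1 hi
  rho_mul_rho i h1 hi := rho_mul_rho n i h1 hi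
  rho_one_sq := rho_one_sq n hn

/-- On strings at positions 1 and 2, every ρ_j with j ≥ 3 acts trivially. -/
theorem descWord_rho_apply (n m : ℕ) (hn : 2 ≤ n) (h : Fiber) :
    descWord (rho n) (m + 2) ((1, 2), h) = ((1, 2), rhoTwo * rhoOne * h) := by
  induction m with
  | zero =>
    simp only [descWord, Equiv.Perm.mul_apply, Equiv.Perm.one_apply, rho_apply, rhoLabel]
    grind
  | succ m ih =>
    rw [descWord, Equiv.Perm.mul_apply, ih, rho_apply]
    simp [rhoLabel]

theorem descWord_rho_sq_ne_one (n : ℕ) (hn : 2 ≤ n) : descWord (rho n) n ^ 2 ≠ 1 := by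
  intro h1
  obtain ⟨m, rfl⟩ : ∃ m, n = m + 2 := ⟨n - 2, by omega⟩
  have h2 := congrArg (fun g => (g ((1, 2), 1)).2) h1
  simp only [sq, Equiv.Perm.mul_apply, descWord_rho_apply _ _ hn, Equiv.Perm.one_apply] at h2
  revert h2
  decide

theorem sigma_inv_fst (i : ℕ) (x : State) :
    ((sigma i)⁻¹ x).1.1 = Equiv.swap i (i + 1) x.1.1 := by
  obtain ⟨y, rfl⟩ := (sigma i).surjective x
  obtain ⟨⟨j, k⟩, h⟩ := y
  rw [← Equiv.Perm.mul_apply, inv_mul_cancel, Equiv.Perm.one_apply, sigma_apply]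
  exact (Equiv.swap_apply_self _ _ _).symm

/-- The fixed positions above m + 1 are included because the induction step needs m + 2 to be
unmoved before the last swap. -/
theorem ascWord_inv_fst (m : ℕ) (x : State) :
    (x.1.1 = 1 → (((ascWord sigma m)⁻¹ x).1.1 = m + 1)) ∧
    (2 ≤ x.1.1 → x.1.1 ≤ m + 1 → (((ascWord sigma m)⁻¹ x).1.1 = x.1.1 - 1)) ∧
    (m + 1 < x.1.1 → (((ascWord sigma m)⁻¹ x).1.1 = x.1.1)) := by
  induction m with
  | zero => simp only [ascWord, inv_one, Equiv.Perm.one_apply]; grind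
  | succ m ih =>
    simp only [ascWord, mul_inv_rev, Equiv.Perm.mul_apply, sigma_inv_fst, Equiv.swap_apply_def]
    grind

theorem dvd_of_torsionWord_pow_eq_one (n m e : ℕ)
    (he : torsionWord sigma (rho n) m ^ e = 1) : m + 1 ∣ e := by
  have h1 : ∀ x : State, (torsionWord sigma (rho n) m x).1.1 =
      ((ascWord sigma m)⁻¹ (rho n 1 x)).1.1 := fun x => rfl
  have h2 : ∀ x : State, (rho n 1 x).1.1 = x.1.1 := fun x => rfl
  -- Only the first string is tracked; the second position 0 is an arbitrary choice.
  refine dvd_of_pow_eq_one_of_rotation (pos := fun x : State => x.1.1) (k := m + 1) (by omega) ?_ ?_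
    (x := ((m + 1, 0), 1)) rfl he
  · intro x hx1 hx2
    exact (h1 x).trans ((ascWord_inv_fst m (rho n 1 x)).2.1 hx1 hx2)
  · intro x hx
    exact (h1 x).trans ((ascWord_inv_fst m (rho n 1 x)).1 hx)

end PairModel

/-! ### Transfer to the presented group and conclusion -/

namespace BraidGroupRP2

theorem isVanBuskirkSystem (n : ℕ) (hn : 2 ≤ n) :
    IsVanBuskirkSystem n (sigma n) (rho n) := by
  have key : ∀ u v : FreeGroup (VanBuskirkGen n), VanBuskirkRel n (u * v⁻¹) →
      (PresentedGroup.mk _ u : BraidGroupRP2 n) = PresentedGroup.mk _ v := fun u v h => by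
    rw [← mul_inv_eq_one, ← map_inv, ← map_mul]
    exact PresentedGroup.one_of_mem h
  have hasc : ∀ m, (PresentedGroup.mk _ (ascWord (freeSigma n) m) : BraidGroupRP2 n) =
      ascWord (sigma n) m := fun m => by
    induction m with
    | zero => rfl
    | succ m ih => rw [ascWord, map_mul, ih]; rfl
  have hdesc : ∀ m, (PresentedGroup.mk _ (descWord (freeSigma n) m) : BraidGroupRP2 n) =
      descWord (sigma n) m := fun m => by
    induction m with
    | zero => rfl
    | succ m ih => rw [descWord, map_mul, ih]; rfl
  refine { sigma_comm := ?_, braid := ?_, sigma_rho_comm := ?_, sigma_rho_sigma := ?_,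
           rho_mul_rho := ?_, rho_one_sq := ?_ }
  · exact fun i j h1 hij hj => key _ _ (.sigma_comm i j h1 hij hj)
  · exact fun i h1 hi => key _ _ (.braid i h1 hi)
  · exact fun i j h1 hi hj1 hj hij hij' => key _ _ (.sigma_rho_comm i j h1 hi hj1 hj hij hij')
  · intro i h1 hi
    have h : rho n (i + 1) = (sigma n i)⁻¹ * rho n i * (sigma n i)⁻¹ :=
      key _ _ (.rho_succ i h1 hi)
    rw [h]
    simp [mul_assoc]
  · intro i h1 hi
    have h : (rho n (i + 1))⁻¹ * (rho n i)⁻¹ * rho n (i + 1) * rho n i = sigma n i ^ 2 :=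
      key _ _ (.rho_commutator i h1 hi)
    rw [← h]
    simp [mul_assoc]
  · have h : rho n 1 ^ 2 = PresentedGroup.mk _ (ascWord (freeSigma n) (n - 2) *
        freeSigma n (n - 1) ^ 2 * descWord (freeSigma n) (n - 2)) := key _ _ .rho_one_sq
    rw [h, map_mul, map_mul, hasc, hdesc]
    obtain ⟨m, rfl⟩ : ∃ m, n = m + 2 := ⟨n - 2, by omega⟩
    change ascWord (sigma (m + 2)) m * sigma (m + 2) (m + 1) ^ 2 * descWord (sigma (m + 2)) m =
      ascWord (sigma (m + 2)) m * sigma (m + 2) (m + 1) *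
        (sigma (m + 2) (m + 1) * descWord (sigma (m + 2)) m)
    simp only [sq, mul_assoc]

/-- The homomorphism out of `B_n(ℝP²)` determined by elements subject to Van Buskirk's
relations. -/
theorem exists_hom {G : Type*} [Group G] {n : ℕ} (hn : 2 ≤ n) {s r : ℕ → G}
    (h : IsVanBuskirkSystem n s r) : ∃ f : BraidGroupRP2 n →* G,
      (∀ i, 1 ≤ i → i < n → f (sigma n i) = s i) ∧ ∀ j, 1 ≤ j → j ≤ n → f (rho n j) = r j := by
  let φ : VanBuskirkGen n → G := fun x => match x with
    | .sigma i _ _ => s i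
    | .rho j _ _ => r j
  have hs : ∀ i, 1 ≤ i → i < n → FreeGroup.lift φ (freeSigma n i) = s i := fun i h1 hi => by
    rw [freeSigma, dif_pos ⟨h1, hi⟩, FreeGroup.lift_apply_of]
  have hr : ∀ j, 1 ≤ j → j ≤ n → FreeGroup.lift φ (freeRho n j) = r j := fun j h1 hj => by
    rw [freeRho, dif_pos ⟨h1, hj⟩, FreeGroup.lift_apply_of]
  have hasc : ∀ m < n, FreeGroup.lift φ (ascWord (freeSigma n) m) = ascWord s m := fun m hm => by
    induction m with
    | zero => exact map_one _
    | succ m ih => rw [ascWord, map_mul, ih (by omega), hs _ (by omega) hm, ascWord]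
  have hdesc : ∀ m < n, FreeGroup.lift φ (descWord (freeSigma n) m) = descWord s m :=
    fun m hm => by
    induction m with
    | zero => exact map_one _
    | succ m ih => rw [descWord, map_mul, ih (by omega), hs _ (by omega) hm, descWord]
  have hrel : ∀ w ∈ {w | VanBuskirkRel n w}, FreeGroup.lift φ w = 1 := by
    intro w hw
    cases hw with
    | sigma_comm i j hi hij hj =>
      rw [map_mul, map_inv, mul_inv_eq_one, map_mul, map_mul, hs i hi (by omega),
        hs j (by omega) hj]
      exact h.sigma_comm i j hi hij hj
    | braid i hi hin =>
      simp only [map_mul, map_inv, mul_inv_eq_one, hs i hi (by omega), hs (i + 1) (by omega) hin]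
      exact h.braid i hi hin
    | sigma_rho_comm i j hi hin hj hjn hji hji' =>
      rw [map_mul, map_inv, mul_inv_eq_one, map_mul, map_mul, hs i hi hin, hr j hj hjn]
      exact h.sigma_rho_comm i j hi hin hj hjn hji hji'
    | rho_succ i hi hin =>
      simp only [map_mul, map_inv, mul_inv_eq_one, hs i hi hin, hr i hi (by omega),
        hr (i + 1) (by omega) hin]
      rw [← h.sigma_rho_sigma i hi hin]
      simp [mul_assoc]
    | rho_commutator i hi hin =>
      simp only [map_mul, map_inv, map_pow, hs i hi hin, hr i hi (by omega),
        hr (i + 1) (by omega) hin]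
      rw [mul_assoc _ (r (i + 1)), h.rho_mul_rho i hi hin]
      simp [mul_assoc]
    | rho_one_sq =>
      rw [map_mul, map_inv, mul_inv_eq_one, map_mul, map_mul, map_pow, map_pow,
        hs _ (by omega) (by omega), hr 1 le_rfl (by omega), hasc _ (by omega), hdesc _ (by omega),
        h.rho_one_sq]
      obtain ⟨m, rfl⟩ : ∃ m, n = m + 2 := ⟨n - 2, by omega⟩
      change ascWord s m * s (m + 1) * (s (m + 1) * descWord s m) =
        ascWord s m * s (m + 1) ^ 2 * descWord s m
      simp only [sq, mul_assoc]
  exact ⟨PresentedGroup.toGroup hrel, hs, hr⟩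

theorem exists_hom_pairModel (n : ℕ) (hn : 2 ≤ n) :
    ∃ f : BraidGroupRP2 n →* Equiv.Perm PairModel.State, ∀ m < n,
      f (torsionWord (sigma n) (rho n) m) = torsionWord PairModel.sigma (PairModel.rho n) m := by
  obtain ⟨f, hs, hr⟩ := exists_hom hn (PairModel.isVanBuskirkSystem n hn)
  have hasc : ∀ m < n, f (ascWord (sigma n) m) = ascWord PairModel.sigma m := fun m hm => by
    induction m with
    | zero => exact map_one _
    | succ m ih => rw [ascWord, map_mul, ih (by omega), hs _ (by omega) hm, ascWord]
  refine ⟨f, fun m hm => ?_⟩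
  rw [torsionWord, map_mul, map_inv, hasc m hm, hr 1 le_rfl (by omega), torsionWord]

theorem torsionWord_pow_ne_one (N : ℕ) :
    torsionWord (sigma (N + 2)) (rho (N + 2)) (N + 1) ^ (2 * (N + 2)) ≠ 1 := by
  obtain ⟨f, hf⟩ := exists_hom_pairModel (N + 2) (by omega)
  intro h
  have h1 := congrArg f h
  rw [map_pow, map_one, hf (N + 1) (by omega), mul_comm 2, pow_mul,
    (PairModel.isVanBuskirkSystem (N + 2) (by omega)).torsionWord_pow (N + 1) (by omega)] at h1
  exact PairModel.descWord_rho_sq_ne_one (N + 2) (by omega) h1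

theorem dvd_of_torsionWord_pow_eq_one (n m e : ℕ) (hn : 2 ≤ n) (hm : m < n)
    (he : torsionWord (sigma n) (rho n) m ^ e = 1) : m + 1 ∣ e := by
  obtain ⟨f, hf⟩ := exists_hom_pairModel n hn
  have h1 := congrArg f he
  rw [map_pow, map_one, hf m hm] at h1
  exact PairModel.dvd_of_torsionWord_pow_eq_one n m e h1

end BraidGroupRP2

theorem proposition13 (n : ℕ) (hn : 2 ≤ n) :
    Nonempty
        (Subgroup.closure {BraidGroupRP2.a n, BraidGroupRP2.halfTwist n} ≃*
          QuaternionGroup (2 * n)) ∧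
      Nonempty
        (Subgroup.closure
            {BraidGroupRP2.b n, BraidGroupRP2.halfTwist n * (BraidGroupRP2.a n)⁻¹} ≃*
          QuaternionGroup (2 * (n - 1))) := by
  obtain ⟨N, rfl⟩ : ∃ N, n = N + 2 := ⟨n - 2, by omega⟩
  have h := BraidGroupRP2.isVanBuskirkSystem (N + 2) hn
  have ha : BraidGroupRP2.a (N + 2) = torsionWord (BraidGroupRP2.sigma (N + 2))
      (BraidGroupRP2.rho (N + 2)) (N + 1) := by
    rw [BraidGroupRP2.a, descWord_inv]; rfl
  have hb : BraidGroupRP2.b (N + 2) = torsionWord (BraidGroupRP2.sigma (N + 2))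
      (BraidGroupRP2.rho (N + 2)) N := by
    rw [BraidGroupRP2.b, descWord_inv]; rfl
  have hΔ : BraidGroupRP2.halfTwist (N + 2) =
      halfTwistWord (BraidGroupRP2.sigma (N + 2)) (N + 1) := rfl
  have ha4 := h.torsionWord_pow_eq_one
  have hab := h.torsionWord_pow_eq
  have hne := BraidGroupRP2.torsionWord_pow_ne_one N
  rw [ha, hb, hΔ, show N + 2 - 1 = N + 1 from rfl]
  constructor
  · refine nonempty_closure_mulEquiv_quaternionGroup (by omega) ?_
      h.halfTwistWord_mul_torsionWord h.halfTwistWord_sq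
    rw [orderOf_eq_four_mul ha4 hne fun e =>
      BraidGroupRP2.dvd_of_torsionWord_pow_eq_one _ _ e hn (by omega)]
    ring
  · refine nonempty_closure_mulEquiv_quaternionGroup (by omega) ?_
      h.halfTwistWord_mul_inv_mul (h.halfTwistWord_mul_inv_sq.trans hab.symm)
    -- Nontriviality of b^{2(n-1)} is inherited from a^{2n}.
    rw [orderOf_eq_four_mul (k := N + 1) ?_ (hab ▸ hne) fun e =>
      BraidGroupRP2.dvd_of_torsionWord_pow_eq_one _ _ e hn (by omega)]
    · ring
    · rw [show 4 * (N + 1) = 2 * (N + 1) * 2 by ring, pow_mul, hab, ← pow_mul, ← ha4]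
      congr 1
      ring
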